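/- Let $T>0$, $\mathcal O=\mathbb T^3$, $\delta\in(0,1)$, $q\in[1,3)$, $r\in[1,\infty)$, $\alpha\in[1,\tfrac32)$ with $q(1+2\delta)\ge 3(1+\delta)$, and let $$\mathcal X_T=\mathcal X_{\varrho}\times\mathcal X_{\sqrt\varrho}\times\mathcal X_{\varrho\mathbf u}\times\mathcal X_{\sqrt\varrho\,\mathbf u}\times\mathcal X_{\varrho^{1/(2+\delta)}\mathbf u}\times\mathcal X_W,$$ where $\mathcal X_\varrho=C([0,T];L^q(\mathcal O))$, $\mathcal X_{\sqrt\varrho}=C([0,T];L^{2q}(\mathcal O))\cap(L^\infty(0,T;H^1(\mathcal O)),w^*)$, $\mathcal X_{\varrho\mathbf u}=L^r(0,T;L^\alpha(\mathcal O;\mathbb R^3))\cap C_w([0,T];L^{3/2}(\mathcal O;\mathbb R^3))$, $\mathcal X_{\sqrt\varrho\,\mathbf u}=(L^\infty(0,T;L^2(\mathcal O;\mathbb R^3)),w^*)$, $\mathcal X_{\varrho^{1/(2+\delta)}\mathbf u}=(L^\infty(0,T;L^{2+\delta}(\mathcal O;\mathbb R^3)),w^*)$ and $\mathcal X_W=C([0,T];\mathbb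 R)$, with the product topology and its Borel $\sigma$-algebra. On a probability space $(\Omega,\mathcal F,\mathbb P)$ let $\varrho_n\ge 0$ be random densities and $\mathbf u_n$ random velocity fields on $\mathcal O\times(0,T)$, $n\in\mathbb N$, and $W$ a random continuous path, such that $$\mu_n=\bigl(\varrho_n,\sqrt{\varrho_n},\varrho_n\mathbf u_n,\sqrt{\varrho_n}\,\mathbf u_n,\varrho_n^{\frac1{2+\delta}}\mathbf u_n,W\bigr)$$ is an $\mathcal X_T$-valued Borel random variable for every $n$. On a second probability space $(\widetilde\Omega,\widetilde{\mathcal F},\widetilde{\mathbb P})$ let $\widetilde\mu_n=(\widetilde\varrho_n,\widetilde\vartheta_n,\widetilde{\mathbf m}_n,\widetilde{\mathbf q}_n,\widetilde{\mathbf r}_n,\widetilde W_n)$, $n\in\mathbb N$, and $\widetilde\mu=(\widetilde\varrho,\widetilde\vartheta,\widetilde{\mathbf m},\widetilde{\mathbf q},\widetilde{\mathbf r},\widetilde W)$ be $\mathcal X_T$-valued Borel random variables such that, for a subsequence $(\mu_{k_n})_n$, the law of $\widetilde\mu_n$ on $\mathcal X_T$ equals the law of $\mu_{k_n}$ for every $n$,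 and $\widetilde\mu_n\to\widetilde\mu$ in $\mathcal X_T$, $\widetilde{\mathbb P}$-a.s. Then $\widetilde{\mathbb P}$-a.s., for every $n\in\mathbb N$, almost everywhere in $\mathcal O\times(0,T)$, one has $\widetilde\varrho_n\ge0$ and $$(\widetilde\vartheta_n,\widetilde{\mathbf m}_n,\widetilde{\mathbf q}_n)=\Bigl(\sqrt{\widetilde\varrho_n},\ \widetilde\varrho_n^{\frac{1+\delta}{2+\delta}}\,\widetilde{\mathbf r}_n,\ \widetilde\varrho_n^{\frac{\delta}{2(2+\delta)}}\,\widetilde{\mathbf r}_n\Bigr),$$ and likewise, $\widetilde{\mathbb P}$-a.s., almost everywhere in $\mathcal O\times(0,T)$, $\widetilde\varrho\ge0$ and $$(\widetilde\vartheta,\widetilde{\mathbf m},\widetilde{\mathbf q})=\Bigl(\sqrt{\widetilde\varrho},\ \widetilde\varrho^{\frac{1+\delta}{2+\delta}}\,\widetilde{\mathbf r},\ \widetilde\varrho^{\frac{\delta}{2(2+\delta)}}\,\widetilde{\mathbf r}\Bigr).$$ -/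

import Mathlib

namespace DegenerateNS

noncomputable section

open MeasureTheory Filter Topology Set
open scoped ENNReal ContDiff

/-- The closed time interval `[0,T]`, with the Lebesgue measure of the subtype. Since its endpoints
are null, Lebesgue spaces over it are the Lebesgue spaces over `(0,T)`. -/
abbrev Time (T : ℝ) : Type := Set.Icc (0 : ℝ) T

instance instMeasureSpaceTime (T : ℝ) : MeasureSpace (Time T) := Measure.Subtype.measureSpace

/-- The three-dimensional flat torus `𝒪 = 𝕋³`, with its Haar measure. -/
abbrev Torus : Type := UnitAddTorus (Fin 3)

/-- The space `ℝ³` in which the velocity takes its values. -/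
abbrev Vec : Type := EuclideanSpace ℝ (Fin 3)

/-- The scalar Lebesgue space `L^p(𝒪)`, for a real exponent `p`. -/
abbrev LpS (p : ℝ) : Type := Lp ℝ (ENNReal.ofReal p) (volume : Measure Torus)

/-- The Lebesgue space `L^p(𝒪; ℝ³)` of vector fields, for a real exponent `p`. -/
abbrev LpV (p : ℝ) : Type := Lp Vec (ENNReal.ofReal p) (volume : Measure Torus)

/-! ### Admissible exponents

The exponents are taken from `δ ∈ (0,1)`, `q ∈ [1,3)`, `r ∈ [1,∞)`, `α ∈ [1,3/2)`; the instances
below record that the Lebesgue exponents built from them are at least `1`. -/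

theorem fact_one_le_ofReal {p : ℝ} (hp : 1 ≤ p) : Fact (1 ≤ ENNReal.ofReal p) :=
  ⟨by simpa using ENNReal.ofReal_le_ofReal hp⟩

instance instFactQ (q : Set.Ico (1 : ℝ) 3) : Fact (1 ≤ ENNReal.ofReal (q : ℝ)) :=
  fact_one_le_ofReal q.2.1

instance instFactTwoQ (q : Set.Ico (1 : ℝ) 3) : Fact (1 ≤ ENNReal.ofReal (2 * (q : ℝ))) :=
  fact_one_le_ofReal (by have := q.2.1; linarith)

instance instFactR (r : Set.Ici (1 : ℝ)) : Fact (1 ≤ ENNReal.ofReal (r : ℝ)) :=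
  fact_one_le_ofReal r.2

instance instFactA (α : Set.Ico (1 : ℝ) (3 / 2)) : Fact (1 ≤ ENNReal.ofReal (α : ℝ)) :=
  fact_one_le_ofReal α.2.1

instance instFactD (δ : Set.Ioo (0 : ℝ) 1) : Fact (1 ≤ ENNReal.ofReal (2 + (δ : ℝ))) :=
  fact_one_le_ofReal (by have := δ.2.1; linarith)

instance instFactTwo : Fact (1 ≤ ENNReal.ofReal (2 : ℝ)) := fact_one_le_ofReal (by norm_num)

instance instFactThreeHalves : Fact (1 ≤ ENNReal.ofReal (3 / 2 : ℝ)) :=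
  fact_one_le_ofReal (by norm_num)

/-! ### The Sobolev space `H¹(𝒪)` -/

/-- Smooth functions on the torus: those whose periodic lift to `ℝ³` is smooth. -/
def IsSmooth (φ : Torus → ℝ) : Prop :=
  ContDiff ℝ ∞ (fun y : Fin 3 → ℝ => φ (fun i => ((y i : ℝ) : UnitAddCircle)))

/-- The partial derivative `∂ᵢφ` of a function on the torus. -/
def partialDeriv (i : Fin 3) (φ : Torus → ℝ) (x : Torus) : ℝ :=
  deriv (fun s : ℝ => φ (x + Pi.single i (s : UnitAddCircle))) 0

/-- The space `L²(𝒪) × L²(𝒪)³` of candidates for pairs `(u, ∇u)`, with its Hilbert norm. -/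
abbrev L2Jet : Type :=
  WithLp 2 (Lp ℝ 2 (volume : Measure Torus) × PiLp 2 (fun _ : Fin 3 => Lp ℝ 2 (volume : Measure Torus)))

/-- The Sobolev space `H¹(𝒪)`, identified with the space of the pairs `(u, ∇u)` in `L²`, where `∇u`
is the weak gradient: `∫ u ∂ᵢφ = - ∫ (∂ᵢu) φ` for every smooth `φ` (`f` and `g` are `∂ᵢφ` and `φ` as
elements of `L²`). The norm is `‖u‖² = ‖u‖²_{L²} + ∑ ‖∂ᵢu‖²_{L²}`. -/
def H1 : Submodule ℝ L2Jet where
  carrier := {z | ∀ φ : Torus → ℝ, IsSmooth φ → ∀ (i : Fin 3) (f g : Lp ℝ 2 (volume : Measure Torus)),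
    f =ᵐ[volume] partialDeriv i φ → g =ᵐ[volume] φ →
      inner ℝ f z.fst = - inner ℝ g (z.snd i)}
  zero_mem' := by
    intro φ _ i f g _ _
    simp
  add_mem' := by
    intro z w hz hw φ hφ i f g hf hg
    have h1 := hz φ hφ i f g hf hg
    have h2 := hw φ hφ i f g hf hg
    simp only [WithLp.add_fst, WithLp.add_snd, PiLp.add_apply, inner_add_right, h1, h2]
    ring
  smul_mem' := by
    intro c z hz φ hφ i f g hf hg
    have h1 := hz φ hφ i f g hf hg
    simp only [WithLp.smul_fst, WithLp.smul_snd, PiLp.smul_apply, inner_smul_right, h1]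
    ring

/-- The function underlying an element of `H¹(𝒪)`. -/
def H1.fn (z : H1) : Lp ℝ 2 (volume : Measure Torus) := (z : L2Jet).fst

/-! ### Path spaces -/

/-- The Bochner space `L^∞(0,T;B)`, as a type that is going to carry the weak-star topology. -/
def LInftyWStar (T : ℝ) (B : Type*) [NormedAddCommGroup B] : Type _ :=
  Lp B ∞ (volume : Measure (Time T))

/-- The element of `L^∞(0,T;B)` as an (almost everywhere defined) function of time. -/
def LInftyWStar.toFun {T : ℝ} {B : Type*} [NormedAddCommGroup B] (u : LInftyWStar T B) :
    Time T → B :=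
  let v : Lp B ∞ (volume : Measure (Time T)) := u
  v

/-- The duality between `L^∞(0,T;B)` and `L¹(0,T;B*)`. -/
def LInftyWStar.pairing {T : ℝ} {B : Type*} [NormedAddCommGroup B] [NormedSpace ℝ B]
    (u : LInftyWStar T B) (φ : Lp (StrongDual ℝ B) 1 (volume : Measure (Time T))) : ℝ :=
  ∫ t, φ t (u.toFun t)

/-- The weak-star topology of `L^∞(0,T;B) = (L¹(0,T;B*))*`, for `B` separable and reflexive: the
coarsest topology for which all pairings with elements of `L¹(0,T;B*)` are continuous. For
`B = L^p(𝒪)` one has `B* = L^{p'}(𝒪)`, and for `B = H¹(𝒪)` one has `B* = H⁻¹(𝒪)`. -/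
instance LInftyWStar.instTopologicalSpace {T : ℝ} {B : Type*} [NormedAddCommGroup B]
    [NormedSpace ℝ B] : TopologicalSpace (LInftyWStar T B) :=
  TopologicalSpace.induced LInftyWStar.pairing Pi.topologicalSpace

/-- `𝒳_ϱ = C([0,T]; L^q(𝒪))`, with the topology of uniform convergence. -/
abbrev XRho (T : ℝ) (q : Set.Ico (1 : ℝ) 3) : Type := C(Time T, LpS (q : ℝ))

/-- `𝒳_{√ϱ} = C([0,T]; L^{2q}(𝒪)) ∩ (L^∞(0,T; H¹(𝒪)), w*)`. An element of the intersection is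
given as a pair of elements of the two spaces that are the same function; the topology is the one
generated by the topologies of the two spaces. -/
abbrev XSqrtRho (T : ℝ) (q : Set.Ico (1 : ℝ) 3) : Type :=
  {p : C(Time T, LpS (2 * (q : ℝ))) × LInftyWStar T H1 //
    ∀ᵐ t : Time T, ∀ᵐ x : Torus, p.1 t x = H1.fn (p.2.toFun t) x}

/-- `C_w([0,T]; L^{3/2}(𝒪;ℝ³))`: weakly continuous functions, with the topology of the convergence
of `t ↦ ⟨ψ, u(t)⟩`, uniformly in `t`, for every `ψ` in the dual of `L^{3/2}`. -/
abbrev CWeak (T : ℝ) : Type := C(Time T, WeakSpace ℝ (LpV (3 / 2)))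

/-- The value at time `t`, as an element of `L^{3/2}`. -/
def CWeak.at {T : ℝ} (u : CWeak T) (t : Time T) : LpV (3 / 2) :=
  (toWeakSpace ℝ (LpV (3 / 2))).symm (u t)

/-- `𝒳_{ϱu} = L^r(0,T; L^α(𝒪)) ∩ C_w([0,T]; L^{3/2}(𝒪))`, with the same convention for
intersections. -/
abbrev XMom (T : ℝ) (r : Set.Ici (1 : ℝ)) (α : Set.Ico (1 : ℝ) (3 / 2)) : Type :=
  {p : Lp (LpV (α : ℝ)) (ENNReal.ofReal (r : ℝ)) (volume : Measure (Time T)) × CWeak T //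
    ∀ᵐ t : Time T, ∀ᵐ x : Torus, p.1 t x = CWeak.at p.2 t x}

/-- The path space `𝒳_T`, the product of `𝒳_ϱ`, `𝒳_{√ϱ}`, `𝒳_{ϱu}`,
`𝒳_{√ϱu} = (L^∞(0,T;L²(𝒪)), w*)`, `𝒳_{ϱ^{1/(2+δ)}u} = (L^∞(0,T;L^{2+δ}(𝒪)), w*)` and
`𝒳_W = C([0,T];ℝ)`. -/
structure PathSpace (T : ℝ) (δ : Set.Ioo (0 : ℝ) 1) (q : Set.Ico (1 : ℝ) 3) (r : Set.Ici (1 : ℝ))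
    (α : Set.Ico (1 : ℝ) (3 / 2)) where
  rhoPart : XRho T q
  thetaPart : XSqrtRho T q
  momPart : XMom T r α
  qPart : LInftyWStar T (LpV 2)
  rPart : LInftyWStar T (LpV (2 + (δ : ℝ)))
  wienerPart : C(Time T, ℝ)

variable {T : ℝ} {δ : Set.Ioo (0 : ℝ) 1} {q : Set.Ico (1 : ℝ) 3} {r : Set.Ici (1 : ℝ)}
  {α : Set.Ico (1 : ℝ) (3 / 2)}

namespace PathSpace

/-- The tuple underlying an element of the path space. -/
def toProd (z : PathSpace T δ q r α) :
    XRho T q × XSqrtRho T q × XMom T r α × LInftyWStar T (LpV 2) ×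
      LInftyWStar T (LpV (2 + (δ : ℝ))) × C(Time T, ℝ) :=
  (z.rhoPart, z.thetaPart, z.momPart, z.qPart, z.rPart, z.wienerPart)

/-- The product topology. -/
instance instTopologicalSpace : TopologicalSpace (PathSpace T δ q r α) :=
  TopologicalSpace.induced toProd inferInstance

/-- The Borel `σ`-algebra of the product topology. -/
instance instMeasurableSpace : MeasurableSpace (PathSpace T δ q r α) := borel _

instance instBorelSpace : BorelSpace (PathSpace T δ q r α) := ⟨rfl⟩

/-- The value `ϱ(t,x)` of the first component. -/
def rho (z : PathSpace T δ q r α) (t : Time T) (x : Torus) : ℝ := z.rhoPart t x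

/-- The value `ϑ(t,x)` of the second component. -/
def theta (z : PathSpace T δ q r α) (t : Time T) (x : Torus) : ℝ := z.thetaPart.1.1 t x

/-- The value `m(t,x)` of the third component. -/
def mom (z : PathSpace T δ q r α) (t : Time T) (x : Torus) : Vec := CWeak.at z.momPart.1.2 t x

/-- The value `q(t,x)` of the fourth component. -/
def qf (z : PathSpace T δ q r α) (t : Time T) (x : Torus) : Vec := z.qPart.toFun t x

/-- The value `r(t,x)` of the fifth component. -/
def rf (z : PathSpace T δ q r α) (t : Time T) (x : Torus) : Vec := z.rPart.toFun t x

/-- The element `z` of the path space is the tuple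
`(ϱ, √ϱ, ϱu, √ϱ u, ϱ^{1/(2+δ)} u, W)` of a nonnegative density `ϱ`, a velocity `u` and a path `W`:
the identities hold at almost every time almost everywhere on the torus. -/
def IsTupleOf (z : PathSpace T δ q r α) (ϱ : Time T → Torus → ℝ) (u : Time T → Torus → Vec)
    (W : C(Time T, ℝ)) : Prop :=
  (∀ᵐ t : Time T, ∀ᵐ x : Torus,
    0 ≤ ϱ t x ∧
    z.rho t x = ϱ t x ∧
    z.theta t x = Real.sqrt (ϱ t x) ∧
    z.mom t x = ϱ t x • u t x ∧
    z.qf t x = Real.sqrt (ϱ t x) • u t x ∧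
    z.rf t x = (ϱ t x) ^ (1 / (2 + (δ : ℝ))) • u t x) ∧
  z.wienerPart = W

/-- The identities `(ϑ, m, q) = (√ϱ, ϱ^{(1+δ)/(2+δ)} r, ϱ^{δ/(2(2+δ))} r)` almost everywhere in
`𝒪 × (0,T)` (at almost every time, almost everywhere on the torus), for the components of an element
of the path space; that `ϱ` is nonnegative, so that the root and the powers are meant literally, is
part of the claim. -/
def Identified (z : PathSpace T δ q r α) : Prop :=
  ∀ᵐ t : Time T, ∀ᵐ x : Torus,
    0 ≤ z.rho t x ∧
    z.theta t x = Real.sqrt (z.rho t x) ∧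
    z.mom t x = (z.rho t x) ^ ((1 + (δ : ℝ)) / (2 + (δ : ℝ))) • z.rf t x ∧
    z.qf t x = (z.rho t x) ^ ((δ : ℝ) / (2 * (2 + (δ : ℝ)))) • z.rf t x

end PathSpace

end

end DegenerateNS

/-! The velocity can be eliminated: since `1 = (1+δ)/(2+δ) + 1/(2+δ)` and `1/2 = δ/(2(2+δ)) +
1/(2+δ)`, the original tuples satisfy identities between the components alone
(`IsTupleOf.identified`). These single out a subset of the path space. If it is Borel, equality of
laws carries it to the new variables; if it is sequentially closed, almost sure convergence carries
it to the limit.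

The obstacle is the product `ϱ^c r`, with `r` converging only weakly-star. The map `ϱ ↦ |ϱ|^c` is
continuous from `L^q` to the dual exponent of `2+δ`, so this is a strong factor times a weak-star
one; its integrals over sets of times, tested by functionals, are continuous where `r` is norm
bounded (`continuousOn_pairing`). Hence the identities are closed on each set `bounded N`
(`isClosed_identified_inter_bounded`). These sets, `N ∈ ℕ`, exhaust the path space, so the
identities form a countable union of closed sets (`measurableSet_identified`). By Banach–Steinhaus a
convergent sequence stays in one of them, which gives stability under limits
(`Identified.of_tendsto`). -/

namespace DegenerateNS

noncomputable section

open MeasureTheory Filter Topology Set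
open scoped ENNReal ContDiff

/-! ### Lebesgue spaces over finite measure spaces -/

section Lebesgue

variable {X E : Type*} [MeasurableSpace X] {μ : Measure X} [NormedAddCommGroup E]

/-- The inclusion of `L^p` in `L¹` over a finite measure space. -/
def lpToL1 [NormedSpace ℝ E] [IsFiniteMeasure μ] (p : ℝ≥0∞) [hp : Fact (1 ≤ p)] :
    Lp E p μ →L[ℝ] Lp E 1 μ :=
  haveI : p.HolderConjugate p.conjExponent := .conjExponent hp.out
  haveI : p.conjExponent.HolderConjugate p := .symm
  haveI : Fact (1 ≤ p.conjExponent) := ⟨by simp [ENNReal.conjExponent]⟩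
  -- Hölder's inequality against the constant `1`, which lies in the conjugate space because `μ` is
  -- finite.
  (ContinuousLinearMap.lsmul ℝ ℝ).holderL μ p.conjExponent p 1 (Lp.const p.conjExponent μ (1 : ℝ))

theorem coeFn_lpToL1 [NormedSpace ℝ E] [IsFiniteMeasure μ] (p : ℝ≥0∞) [hp : Fact (1 ≤ p)]
    (f : Lp E p μ) : lpToL1 p f =ᵐ[μ] f := by
  have : p.HolderConjugate p.conjExponent := .conjExponent hp.out
  have : p.conjExponent.HolderConjugate p := .symm
  have : Fact (1 ≤ p.conjExponent) := ⟨by simp [ENNReal.conjExponent]⟩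
  have h := (ContinuousLinearMap.lsmul ℝ ℝ).coeFn_holder (r := 1)
    (Lp.const p.conjExponent μ (1 : ℝ)) f
  filter_upwards [h, Lp.coeFn_const p.conjExponent μ (1 : ℝ)] with x hx h1
  rw [h1] at hx
  exact hx.trans (by simp)

/-- Triangle inequality and subadditivity of `t ↦ t^c` on `[0,∞)` for `c ≤ 1`. -/
theorem abs_abs_rpow_sub_abs_rpow_le {c : ℝ} (hc : 0 < c) (hc1 : c ≤ 1) (a b : ℝ) :
    |(|a| ^ c - |b| ^ c)| ≤ |a - b| ^ c := by
  have key : ∀ x y : ℝ, |x| ^ c - |y| ^ c ≤ |x - y| ^ c := fun x y => by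
    have h : |x| ^ c ≤ (|x - y| + |y|) ^ c := by
      refine Real.rpow_le_rpow (abs_nonneg _) ?_ hc.le
      simpa using abs_add_le (x - y) y
    have := Real.rpow_add_le_add_rpow (abs_nonneg (x - y)) (abs_nonneg y) hc.le hc1
    linarith
  refine abs_sub_le_iff.2 ⟨key a b, ?_⟩
  rw [abs_sub_comm]
  exact key b a

variable [IsProbabilityMeasure μ] {c : ℝ} {s s' : ℝ≥0∞}

/-- The left side is the `c`-th power of the `L^{s'c}` norm, and norms increase with the exponent on
a probability space. -/
theorem eLpNorm_abs_rpow_le {f : X → ℝ} (hf : AEStronglyMeasurable f μ) (hc : 0 < c)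
    (h : s' * ENNReal.ofReal c ≤ s) :
    eLpNorm (fun x => |f x| ^ c) s' μ ≤ eLpNorm f s μ ^ c := by
  have := eLpNorm_norm_rpow (p := s') (μ := μ) f hc
  simp only [Real.norm_eq_abs] at this
  rw [this]
  exact ENNReal.rpow_le_rpow (eLpNorm_le_eLpNorm_of_exponent_le h hf) hc.le

theorem memLp_abs_rpow {f : X → ℝ} (hf : MemLp f s μ) (hc : 0 < c)
    (h : s' * ENNReal.ofReal c ≤ s) : MemLp (fun x => |f x| ^ c) s' μ := by
  refine ⟨?_, (eLpNorm_abs_rpow_le hf.1 hc h).trans_lt (ENNReal.rpow_lt_top_of_nonneg hc.le hf.2.ne)⟩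
  exact ((Real.continuous_rpow_const hc.le).comp continuous_abs).comp_aestronglyMeasurable hf.1

/-- The superposition operator `f ↦ |f|^c` from `L^s` to `L^{s'}`. -/
def absRpow (hc : 0 < c) (h : s' * ENNReal.ofReal c ≤ s) (f : Lp ℝ s μ) : Lp ℝ s' μ :=
  (memLp_abs_rpow (Lp.memLp f) hc h).toLp

theorem coeFn_absRpow (hc : 0 < c) (h : s' * ENNReal.ofReal c ≤ s) (f : Lp ℝ s μ) :
    absRpow hc h f =ᵐ[μ] fun x => |f x| ^ c :=
  MemLp.coeFn_toLp _

/-- The pointwise inequality makes the operator `c`-Hölder with constant `1`. -/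
theorem continuous_absRpow [Fact (1 ≤ s)] [Fact (1 ≤ s')] (hc : 0 < c) (hc1 : c ≤ 1)
    (h : s' * ENNReal.ofReal c ≤ s) : Continuous (absRpow (μ := μ) hc h) := by
  refine (HolderWith.continuous (C := 1) (r := c.toNNReal) (fun f g => ?_) (by simpa using hc))
  rw [absRpow, absRpow, Lp.edist_toLp_toLp, Lp.edist_def, Real.coe_toNNReal _ hc.le,
    ENNReal.coe_one, one_mul]
  refine (eLpNorm_mono fun x => ?_).trans
    (eLpNorm_abs_rpow_le ((Lp.aestronglyMeasurable f).sub (Lp.aestronglyMeasurable g)) hc h)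
  simp only [Pi.sub_apply, Real.norm_eq_abs]
  rw [abs_of_nonneg (Real.rpow_nonneg (abs_nonneg (f x - g x)) c)]
  exact abs_abs_rpow_sub_abs_rpow_le hc hc1 _ _

end Lebesgue

instance instIsFiniteMeasureTime (T : ℝ) : IsFiniteMeasure (volume : Measure (Time T)) :=
  ⟨by
    have : (volume : Measure (Time T)) univ = volume (Icc (0 : ℝ) T) :=
      Measure.Subtype.volume_univ measurableSet_Icc.nullMeasurableSet
    rw [this]
    exact measure_Icc_lt_top⟩

instance instIsProbabilityMeasureUnitAddCircle :
    IsProbabilityMeasure (volume : Measure UnitAddCircle) :=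
  ⟨by simp [AddCircle.measure_univ (1 : ℝ)]⟩

/-! ### Weak-star convergence in `L^∞(0,T;B)` -/

section WeakStar

variable {T : ℝ} {B Y : Type*} [NormedAddCommGroup B] [NormedSpace ℝ B]
  [NormedAddCommGroup Y] [NormedSpace ℝ Y]

namespace LInftyWStar

/-- An element of `L^∞(0,T;B)` as a continuous functional on `L¹(0,T;B*)`. -/
def functional (u : LInftyWStar T B) :
    Lp (StrongDual ℝ B) 1 (volume : Measure (Time T)) →L[ℝ] ℝ :=
  let v : Lp B ∞ (volume : Measure (Time T)) := u
  ((ContinuousLinearMap.id ℝ (StrongDual ℝ B)).lpPairing volume 1 ∞).flip v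

theorem functional_apply (u : LInftyWStar T B)
    (φ : Lp (StrongDual ℝ B) 1 (volume : Measure (Time T))) : u.functional φ = u.pairing φ :=
  (ContinuousLinearMap.id ℝ (StrongDual ℝ B)).lpPairing_eq_integral φ _

theorem continuous_pairing (φ : Lp (StrongDual ℝ B) 1 (volume : Measure (Time T))) :
    Continuous fun u : LInftyWStar T B => u.pairing φ :=
  (continuous_apply φ).comp (continuous_induced_dom (f := LInftyWStar.pairing))

/-- The elements of `L^∞(0,T;B)` that have norm at most `N` as functionals on `L¹(0,T;B*)`. -/
def dualBall (T : ℝ) (B : Type*) [NormedAddCommGroup B] [NormedSpace ℝ B] (N : ℝ) :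
    Set (LInftyWStar T B) :=
  {u | ∀ φ, |u.pairing φ| ≤ N * ‖φ‖}

theorem isClosed_dualBall (N : ℝ) : IsClosed (dualBall T B N) := by
  simp only [dualBall, ofPred_forall]
  exact isClosed_iInter fun φ =>
    isClosed_le (continuous_abs.comp (continuous_pairing φ)) continuous_const

theorem dualBall_mono {M N : ℝ} (h : M ≤ N) : dualBall T B M ⊆ dualBall T B N :=
  fun _ hu φ => (hu φ).trans (mul_le_mul_of_nonneg_right h (norm_nonneg _))

theorem mem_dualBall_of_le {u : LInftyWStar T B} {N : ℝ} (h : ‖u.functional‖ ≤ N) :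
    u ∈ dualBall T B N := fun φ => by
  rw [← functional_apply]
  exact (u.functional.le_opNorm φ).trans (mul_le_mul_of_nonneg_right h (norm_nonneg _))

/-- Each sequence of pairings converges, hence is bounded; Banach–Steinhaus on the complete space
`L¹(0,T;B*)` makes the bound uniform. -/
theorem exists_forall_mem_dualBall {u : ℕ → LInftyWStar T B} {u₀ : LInftyWStar T B}
    (h : Tendsto u atTop (𝓝 u₀)) : ∃ N : ℝ, ∀ n, u n ∈ dualBall T B N := by
  obtain ⟨N, hN⟩ := banach_steinhaus (g := fun n => (u n).functional) fun φ => by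
    have := (((continuous_pairing φ).tendsto u₀).comp h).norm.bddAbove_range
    obtain ⟨C, hC⟩ := this
    exact ⟨C, fun n => by rw [functional_apply]; exact hC ⟨n, rfl⟩⟩
  exact ⟨N, fun n => mem_dualBall_of_le (hN n)⟩

/-- The underlying function of time as an element of the Bochner space. -/
def toLp (u : LInftyWStar T B) : Lp B ∞ (volume : Measure (Time T)) := u

/-- The function `t ↦ K(t) u(t)`, in `L¹(0,T;Y)`. -/
def apply (K : C(Time T, B →L[ℝ] Y)) (u : LInftyWStar T B) :
    Lp Y 1 (volume : Measure (Time T)) :=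
  (ContinuousLinearMap.id ℝ (B →L[ℝ] Y)).holder 1 (ContinuousMap.toLp 1 volume ℝ K) u.toLp

theorem coeFn_apply (K : C(Time T, B →L[ℝ] Y)) (u : LInftyWStar T B) :
    apply K u =ᵐ[volume] fun t => K t (u.toFun t) := by
  filter_upwards [(ContinuousLinearMap.id ℝ (B →L[ℝ] Y)).coeFn_holder (r := 1)
    (ContinuousMap.toLp 1 volume ℝ K) u.toLp, ContinuousMap.coeFn_toLp (p := 1) (𝕜 := ℝ) volume K]
    with t h1 h2
  rw [h2] at h1
  exact h1

/-- The element `1_E Λ ∘ K` of `L¹(0,T;B*)`. -/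
def testFunction {E : Set (Time T)} (hE : MeasurableSet E) (Λ : StrongDual ℝ Y)
    (K : C(Time T, B →L[ℝ] Y)) : Lp (StrongDual ℝ B) 1 (volume : Measure (Time T)) :=
  (ContinuousLinearMap.lsmul ℝ ℝ).holderL volume ∞ 1 1
    (indicatorConstLp ∞ hE (measure_ne_top _ _) (1 : ℝ))
    (ContinuousMap.toLp 1 volume ℝ
      ((⟨fun A : B →L[ℝ] Y => Λ ∘L A, by fun_prop⟩ : C(B →L[ℝ] Y, StrongDual ℝ B)).comp K))

theorem continuous_testFunction {E : Set (Time T)} (hE : MeasurableSet E) (Λ : StrongDual ℝ Y) :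
    Continuous (testFunction (B := B) hE Λ) :=
  (ContinuousLinearMap.continuous _).comp <|
    (ContinuousLinearMap.continuous _).comp (ContinuousMap.continuous_postcomp _)

/-- Moves `K` from the unknown to the test function, on which it acts continuously in norm. -/
theorem pairing_testFunction [CompleteSpace Y] {E : Set (Time T)} (hE : MeasurableSet E)
    (Λ : StrongDual ℝ Y) (K : C(Time T, B →L[ℝ] Y)) (u : LInftyWStar T B) :
    u.pairing (testFunction hE Λ K) = Λ (∫ t in E, apply K u t) := by
  rw [← ContinuousLinearMap.integral_comp_comm _ (L1.integrable_coeFn _).integrableOn,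
    ← integral_indicator hE, pairing]
  refine integral_congr_ae ?_
  filter_upwards [(ContinuousLinearMap.lsmul ℝ ℝ).coeFn_holder (r := 1)
    (indicatorConstLp ∞ hE (measure_ne_top _ _) (1 : ℝ))
    (ContinuousMap.toLp 1 volume ℝ
      ((⟨fun A : B →L[ℝ] Y => Λ ∘L A, by fun_prop⟩ : C(B →L[ℝ] Y, StrongDual ℝ B)).comp K)),
    ContinuousMap.coeFn_toLp (p := 1) (𝕜 := ℝ) volume
      ((⟨fun A : B →L[ℝ] Y => Λ ∘L A, by fun_prop⟩ : C(B →L[ℝ] Y, StrongDual ℝ B)).comp K),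
    indicatorConstLp_coeFn (p := ∞) (hs := hE) (hμs := measure_ne_top volume E) (c := (1 : ℝ)),
    coeFn_apply K u] with t h1 h2 h3 h4
  have h5 : testFunction hE Λ K t = _ := h1
  rw [h5, h2, h3]
  by_cases ht : t ∈ E <;> simp [ht, h4]

/-- Strong times weak-star: split the test function as `(φ z - φ z₀) + φ z₀`. The first part is at
most `N * ‖φ z - φ z₀‖` on `S`, the second converges by definition of the topology. Without the
bound `N` joint continuity may fail. -/
theorem continuousOn_pairing {Z : Type*} [TopologicalSpace Z]
    {φ : Z → Lp (StrongDual ℝ B) 1 (volume : Measure (Time T))} (hφ : Continuous φ)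
    {u : Z → LInftyWStar T B} (hu : Continuous u) {S : Set Z} {N : ℝ}
    (hS : ∀ z ∈ S, u z ∈ dualBall T B N) :
    ContinuousOn (fun z => (u z).pairing (φ z)) S := by
  intro z₀ _
  have h1 : Tendsto (fun z => N * ‖φ z - φ z₀‖) (𝓝[S] z₀) (𝓝 0) := by
    have : Continuous fun z => N * ‖φ z - φ z₀‖ := by fun_prop
    simpa using (this.tendsto z₀).mono_left nhdsWithin_le_nhds
  have h2 : Tendsto (fun z => (u z).pairing (φ z - φ z₀)) (𝓝[S] z₀) (𝓝 0) :=
    squeeze_zero_norm' (eventually_mem_nhdsWithin.mono fun z hz => hS z hz _) h1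
  have h3 : Tendsto (fun z => (u z).pairing (φ z₀)) (𝓝[S] z₀) (𝓝 ((u z₀).pairing (φ z₀))) :=
    (((continuous_pairing (φ z₀)).comp hu).tendsto z₀).mono_left nhdsWithin_le_nhds
  have h4 := h2.add h3
  rw [zero_add] at h4
  refine h4.congr fun z => ?_
  simp only [← functional_apply, ← map_add, sub_add_cancel]

theorem continuousOn_apply [CompleteSpace Y] {Z : Type*} [TopologicalSpace Z]
    {K : Z → C(Time T, B →L[ℝ] Y)} (hK : Continuous K)
    {u : Z → LInftyWStar T B} (hu : Continuous u) {S : Set Z} {N : ℝ}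
    (hS : ∀ z ∈ S, u z ∈ dualBall T B N) (E : Set (Time T)) (hE : MeasurableSet E)
    (Λ : StrongDual ℝ Y) :
    ContinuousOn (fun z => Λ (∫ t in E, apply (K z) (u z) t)) S := by
  simp only [← pairing_testFunction hE]
  exact continuousOn_pairing ((continuous_testFunction hE Λ).comp hK) hu hS

end LInftyWStar

/-- Equality of two `L¹(0,T;Y)`-valued maps is a closed condition on a closed set on which the
integrals over measurable sets of times depend weakly continuously on the parameter. -/
theorem isClosed_setOf_eq_of_weak [CompleteSpace Y] {Z : Type*} [TopologicalSpace Z] {S : Set Z}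
    (hS : IsClosed S) {f g : Z → Lp Y 1 (volume : Measure (Time T))}
    (hf : ∀ E : Set (Time T), MeasurableSet E → ∀ Λ : StrongDual ℝ Y,
      ContinuousOn (fun z => Λ (∫ t in E, f z t)) S)
    (hg : ∀ E : Set (Time T), MeasurableSet E → ∀ Λ : StrongDual ℝ Y,
      ContinuousOn (fun z => Λ (∫ t in E, g z t)) S) :
    IsClosed {z ∈ S | f z = g z} := by
  have key : {z ∈ S | f z = g z} = S ∩ ⋂ (E : Set (Time T)) (_ : MeasurableSet E)
      (Λ : StrongDual ℝ Y),
      S ∩ (fun z => Λ (∫ t in E, f z t) - Λ (∫ t in E, g z t)) ⁻¹' {0} := by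
    ext z
    simp only [mem_ofPred_eq, mem_inter_iff, mem_iInter, mem_preimage, mem_singleton_iff, sub_eq_zero]
    refine and_congr_right fun hz => ⟨fun h E _ Λ => ⟨hz, by rw [h]⟩, fun h => ?_⟩
    -- An `L¹` function is determined by its integrals over measurable sets, and Hahn–Banach
    -- functionals separate their values.
    refine Lp.ext (Integrable.ae_eq_of_forall_setIntegral_eq _ _ (L1.integrable_coeFn _)
      (L1.integrable_coeFn _) fun E hE _ => ?_)
    exact (SeparatingDual.eq_iff_forall_dual_eq (R := ℝ)).2 fun Λ => (h E hE Λ).2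
  rw [key]
  exact hS.inter <| isClosed_iInter fun E => isClosed_iInter fun hE => isClosed_iInter fun Λ =>
    ((hf E hE Λ).sub (hg E hE Λ)).preimage_isClosed_of_isClosed hS isClosed_singleton

/-- Taking values in a closed set at almost every time is a closed condition. -/
theorem isClosed_setOf_ae_mem {X : Type*} [MetricSpace X] {C : Set X} (hC : IsClosed C) :
    IsClosed {f : C(Time T, X) | ∀ᵐ t, f t ∈ C} := by
  refine isClosed_of_closure_subset fun f hf => ?_
  -- Sequences suffice in this metrizable space, so only countably many null sets of times are
  -- discarded.
  obtain ⟨F, hF, hlim⟩ := mem_closure_iff_seq_limit.1 hf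
  filter_upwards [ae_all_iff.2 hF] with t ht
  exact hC.mem_of_tendsto (((ContinuousEvalConst.continuous_eval_const t).tendsto f).comp hlim)
    (Eventually.of_forall ht)

end WeakStar

variable {T : ℝ} {δ : Set.Ioo (0 : ℝ) 1} {q : Set.Ico (1 : ℝ) 3} {r : Set.Ici (1 : ℝ)}
  {α : Set.Ico (1 : ℝ) (3 / 2)}

/-! ### Multiplication by powers of the density -/

/-- The exponent conjugate to `2 + δ`. -/
def dualExponent (δ : Set.Ioo (0 : ℝ) 1) : ℝ := (2 + (δ : ℝ)) / (1 + (δ : ℝ))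

theorem holderConjugate_dualExponent (δ : Set.Ioo (0 : ℝ) 1) :
    (dualExponent δ).HolderConjugate (2 + (δ : ℝ)) := by
  have h0 := δ.2.1
  refine (Real.holderConjugate_iff.2 ⟨by linarith, ?_⟩).symm
  rw [dualExponent]
  field_simp
  ring

instance instFactDualExponent (δ : Set.Ioo (0 : ℝ) 1) :
    Fact (1 ≤ ENNReal.ofReal (dualExponent δ)) :=
  fact_one_le_ofReal (holderConjugate_dualExponent δ).lt.le

instance instHolderConjugateDualExponent (δ : Set.Ioo (0 : ℝ) 1) :
    ENNReal.HolderConjugate (ENNReal.ofReal (dualExponent δ)) (ENNReal.ofReal (2 + (δ : ℝ))) :=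
  (holderConjugate_dualExponent δ).ennrealOfReal

theorem dualExponent_mul_le (δ : Set.Ioo (0 : ℝ) 1) (q : Set.Ico (1 : ℝ) 3) {c : ℝ}
    (h : c ≤ (1 + (δ : ℝ)) / (2 + (δ : ℝ))) :
    ENNReal.ofReal (dualExponent δ) * ENNReal.ofReal c ≤ ENNReal.ofReal (q : ℝ) := by
  have h0 := δ.2.1
  have hp := (holderConjugate_dualExponent δ).nonneg
  rw [← ENNReal.ofReal_mul hp]
  refine ENNReal.ofReal_le_ofReal ?_
  calc dualExponent δ * c ≤ dualExponent δ * ((1 + (δ : ℝ)) / (2 + (δ : ℝ))) :=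
        mul_le_mul_of_nonneg_left h hp
    _ = 1 := by rw [dualExponent]; field_simp
    _ ≤ q := q.2.1

/-- Pointwise multiplication of elements of `L^{2+δ}(𝒪;ℝ³)` by `|ϱ|^c`, for `ϱ ∈ L^q(𝒪)`. -/
def mulAbsRpow (δ : Set.Ioo (0 : ℝ) 1) (q : Set.Ico (1 : ℝ) 3) {c : ℝ} (hc : 0 < c)
    (h : c ≤ (1 + (δ : ℝ)) / (2 + (δ : ℝ))) :
    C(LpS (q : ℝ), LpV (2 + (δ : ℝ)) →L[ℝ] Lp Vec 1 (volume : Measure Torus)) where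
  toFun ρ := (ContinuousLinearMap.lsmul ℝ ℝ).holderL volume (ENNReal.ofReal (dualExponent δ))
    (ENNReal.ofReal (2 + (δ : ℝ))) 1 (absRpow hc (dualExponent_mul_le δ q h) ρ)
  continuous_toFun := by
    have h0 := δ.2.1
    refine (ContinuousLinearMap.continuous _).comp (continuous_absRpow hc (h.trans ?_) _)
    rw [div_le_one (by linarith)]
    linarith

theorem coeFn_mulAbsRpow {c : ℝ} (hc : 0 < c) (h : c ≤ (1 + (δ : ℝ)) / (2 + (δ : ℝ)))
    (ρ : LpS (q : ℝ)) (v : LpV (2 + (δ : ℝ))) :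
    mulAbsRpow δ q hc h ρ v =ᵐ[volume] fun x => |ρ x| ^ c • v x := by
  filter_upwards [(ContinuousLinearMap.lsmul ℝ ℝ).coeFn_holder (r := 1)
    (absRpow hc (dualExponent_mul_le δ q h) ρ) v,
    coeFn_absRpow hc (dualExponent_mul_le δ q h) ρ] with x h1 h2
  rw [h2] at h1
  exact h1

theorem momExponent_pos (δ : Set.Ioo (0 : ℝ) 1) : 0 < (1 + (δ : ℝ)) / (2 + (δ : ℝ)) := by
  have h0 := δ.2.1
  positivity

theorem sqrtExponent_pos (δ : Set.Ioo (0 : ℝ) 1) : 0 < (δ : ℝ) / (2 * (2 + (δ : ℝ))) := by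
  have h0 := δ.2.1
  positivity

theorem sqrtExponent_le (δ : Set.Ioo (0 : ℝ) 1) :
    (δ : ℝ) / (2 * (2 + (δ : ℝ))) ≤ (1 + (δ : ℝ)) / (2 + (δ : ℝ)) := by
  have h0 := δ.2.1
  rw [div_le_div_iff₀ (by positivity) (by positivity)]
  nlinarith

/-! ### Pairs of a nonnegative density and its square root -/

theorem two_mul_half_le (q : Set.Ico (1 : ℝ) 3) :
    ENNReal.ofReal (2 * (q : ℝ)) * ENNReal.ofReal (1 / 2) ≤ ENNReal.ofReal (q : ℝ) := by
  have := q.2.1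
  rw [← ENNReal.ofReal_mul (by linarith)]
  exact ENNReal.ofReal_le_ofReal (by linarith)

/-- The pairs `(ρ, √ρ)` with `ρ ≥ 0`. -/
def sqrtGraph (q : Set.Ico (1 : ℝ) 3) : Set (LpS (q : ℝ) × LpS (2 * (q : ℝ))) :=
  {p | ∀ᵐ x : Torus, 0 ≤ p.1 x ∧ p.2 x = Real.sqrt (p.1 x)}

/-- Nonnegativity is the equation `|ρ|^1 = ρ`, and then the root is `|ρ|^(1/2)`: two equalities of
continuous maps. -/
theorem isClosed_sqrtGraph (q : Set.Ico (1 : ℝ) 3) : IsClosed (sqrtGraph q) := by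
  have h1 : ENNReal.ofReal (q : ℝ) * ENNReal.ofReal 1 ≤ ENNReal.ofReal (q : ℝ) := by simp
  have key : sqrtGraph q = {p | absRpow one_pos h1 p.1 = p.1} ∩
      {p | p.2 = absRpow one_half_pos (two_mul_half_le q) p.1} := by
    ext p
    have e1 := coeFn_absRpow one_pos h1 p.1
    have e2 := coeFn_absRpow one_half_pos (two_mul_half_le q) p.1
    constructor
    · intro hp
      refine ⟨Lp.ext ?_, Lp.ext ?_⟩
      · filter_upwards [hp, e1] with x hx hx1
        rw [hx1, Real.rpow_one, abs_of_nonneg hx.1]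
      · filter_upwards [hp, e2] with x hx hx2
        rw [hx2, abs_of_nonneg hx.1, hx.2, Real.sqrt_eq_rpow]
    · rintro ⟨hp1, hp2⟩
      replace hp1 : absRpow one_pos h1 p.1 = p.1 := hp1
      replace hp2 : p.2 = absRpow one_half_pos (two_mul_half_le q) p.1 := hp2
      rw [hp1] at e1
      rw [← hp2] at e2
      change ∀ᵐ x : Torus, 0 ≤ p.1 x ∧ p.2 x = Real.sqrt (p.1 x)
      filter_upwards [e1, e2] with x hx1 hx2
      rw [Real.rpow_one] at hx1
      have h0 : 0 ≤ p.1 x := hx1 ▸ abs_nonneg _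
      rw [hx2, abs_of_nonneg h0, Real.sqrt_eq_rpow]
      exact ⟨h0, rfl⟩
  rw [key]
  exact (isClosed_eq ((continuous_absRpow one_pos le_rfl h1).comp continuous_fst)
    continuous_fst).inter (isClosed_eq continuous_snd
      ((continuous_absRpow one_half_pos (by norm_num) (two_mul_half_le q)).comp continuous_fst))

namespace PathSpace

/-! ### The identified elements of the path space -/

theorem continuous_toProd : Continuous (toProd : PathSpace T δ q r α → _) := continuous_induced_dom

theorem continuous_rhoPart : Continuous (rhoPart : PathSpace T δ q r α → _) :=
  continuous_toProd.fst

theorem continuous_thetaPart : Continuous (thetaPart : PathSpace T δ q r α → _) :=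
  continuous_toProd.snd.fst

theorem continuous_momPart : Continuous (momPart : PathSpace T δ q r α → _) :=
  continuous_toProd.snd.snd.fst

theorem continuous_qPart : Continuous (qPart : PathSpace T δ q r α → _) :=
  continuous_toProd.snd.snd.snd.fst

theorem continuous_rPart : Continuous (rPart : PathSpace T δ q r α → _) :=
  continuous_toProd.snd.snd.snd.snd.fst

/-- The momentum as an element of `L¹(0,T;L¹(𝒪;ℝ³))`. -/
def momL1 (z : PathSpace T δ q r α) :
    Lp (Lp Vec 1 (volume : Measure Torus)) 1 (volume : Measure (Time T)) :=
  (lpToL1 (ENNReal.ofReal (α : ℝ))).compLp (lpToL1 (ENNReal.ofReal (r : ℝ)) z.momPart.1.1)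

theorem continuous_momL1 : Continuous (momL1 : PathSpace T δ q r α → _) :=
  (((lpToL1 (E := Vec) (μ := (volume : Measure Torus)) (ENNReal.ofReal (α : ℝ))).compLpL 1
    (volume : Measure (Time T))).continuous.comp (lpToL1 _).continuous).comp
    (continuous_subtype_val.comp continuous_momPart).fst

theorem momL1_ae (z : PathSpace T δ q r α) :
    ∀ᵐ t : Time T, ∀ᵐ x : Torus, momL1 z t x = z.mom t x := by
  filter_upwards [(lpToL1 (E := Vec) (μ := (volume : Measure Torus))
    (ENNReal.ofReal (α : ℝ))).coeFn_compLp (lpToL1 (ENNReal.ofReal (r : ℝ)) z.momPart.1.1),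
    -- `momL1` uses the `L^r(0,T;L^α)` representative while `mom` uses the weakly continuous one;
    -- `z.momPart.2` says that they agree.
    coeFn_lpToL1 (ENNReal.ofReal (r : ℝ)) z.momPart.1.1, z.momPart.2] with t h1 h2 h3
  rw [h2] at h1
  filter_upwards [coeFn_lpToL1 (ENNReal.ofReal (α : ℝ)) (z.momPart.1.1 t), h3] with x h4 h5
  exact (congrArg (fun f : Lp Vec 1 (volume : Measure Torus) => f x) h1).trans (h4.trans h5)

/-- The fourth component as an element of `L¹(0,T;L¹(𝒪;ℝ³))`. -/
def qL1 (z : PathSpace T δ q r α) :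
    Lp (Lp Vec 1 (volume : Measure Torus)) 1 (volume : Measure (Time T)) :=
  LInftyWStar.apply (ContinuousMap.const _ (lpToL1 (ENNReal.ofReal 2))) z.qPart

theorem qL1_ae (z : PathSpace T δ q r α) :
    ∀ᵐ t : Time T, ∀ᵐ x : Torus, qL1 z t x = z.qf t x := by
  filter_upwards [LInftyWStar.coeFn_apply (ContinuousMap.const _ (lpToL1 (ENNReal.ofReal 2)))
    z.qPart] with t h1
  filter_upwards [coeFn_lpToL1 (ENNReal.ofReal 2) (z.qPart.toFun t)] with x h2
  exact (congrArg (fun f : Lp Vec 1 (volume : Measure Torus) => f x) h1).trans h2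

/-- The product `|ϱ|^c r` of a power of the first component and the fifth component, as an element
of `L¹(0,T;L¹(𝒪;ℝ³))`. -/
def powMulR {c : ℝ} (hc : 0 < c) (h : c ≤ (1 + (δ : ℝ)) / (2 + (δ : ℝ)))
    (z : PathSpace T δ q r α) :
    Lp (Lp Vec 1 (volume : Measure Torus)) 1 (volume : Measure (Time T)) :=
  LInftyWStar.apply ((mulAbsRpow δ q hc h).comp z.rhoPart) z.rPart

theorem powMulR_ae {c : ℝ} (hc : 0 < c) (h : c ≤ (1 + (δ : ℝ)) / (2 + (δ : ℝ)))
    (z : PathSpace T δ q r α) :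
    ∀ᵐ t : Time T, ∀ᵐ x : Torus, powMulR hc h z t x = |z.rho t x| ^ c • z.rf t x := by
  filter_upwards [LInftyWStar.coeFn_apply ((mulAbsRpow δ q hc h).comp z.rhoPart) z.rPart] with t h1
  filter_upwards [coeFn_mulAbsRpow hc h (z.rhoPart t) (z.rPart.toFun t)] with x h2
  exact (congrArg (fun f : Lp Vec 1 (volume : Measure Torus) => f x) h1).trans h2

theorem eq_iff_ae_ae_eq {f g : Lp (Lp Vec 1 (volume : Measure Torus)) 1
    (volume : Measure (Time T))} : f = g ↔ ∀ᵐ t : Time T, ∀ᵐ x : Torus, f t x = g t x := by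
  refine ⟨fun h => by simp [h], fun h => Lp.ext ?_⟩
  filter_upwards [h] with t ht using Lp.ext ht

/-- The first two components as a function of time. -/
def rhoTheta (z : PathSpace T δ q r α) : C(Time T, LpS (q : ℝ) × LpS (2 * (q : ℝ))) :=
  z.rhoPart.prodMk z.thetaPart.1.1

theorem continuous_rhoTheta : Continuous (rhoTheta : PathSpace T δ q r α → _) := by
  refine ContinuousMap.continuous_of_continuous_uncurry _ ?_
  have h1 := (continuous_rhoPart (T := T) (δ := δ) (q := q) (r := r) (α := α)).comp
    (continuous_fst (Y := Time T))
  have h2 := (continuous_subtype_val.comp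
    (continuous_thetaPart (T := T) (δ := δ) (q := q) (r := r) (α := α))).fst.comp
    (continuous_fst (Y := Time T))
  exact (continuous_eval.comp (h1.prodMk continuous_snd)).prodMk
    (continuous_eval.comp (h2.prodMk continuous_snd))

/-- Recasts the pointwise identities as one closed condition on continuous paths and two equations
in `L¹(0,T;L¹)`; the absolute values in `powMulR` disappear once `ϱ ≥ 0`. -/
theorem identified_iff (z : PathSpace T δ q r α) :
    z.Identified ↔ (∀ᵐ t, rhoTheta z t ∈ sqrtGraph q) ∧
      momL1 z = powMulR (momExponent_pos δ) le_rfl z ∧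
      qL1 z = powMulR (sqrtExponent_pos δ) (sqrtExponent_le δ) z := by
  rw [eq_iff_ae_ae_eq, eq_iff_ae_ae_eq]
  constructor
  · intro h
    refine ⟨?_, ?_, ?_⟩
    · filter_upwards [h] with t ht
      change ∀ᵐ x : Torus, _
      filter_upwards [ht] with x hx using ⟨hx.1, hx.2.1⟩
    · filter_upwards [h, momL1_ae z, powMulR_ae (momExponent_pos δ) le_rfl z] with t h0 h1 h2
      filter_upwards [h0, h1, h2] with x h0 h1 h2
      rw [h1, h2, abs_of_nonneg h0.1, h0.2.2.1]
    · filter_upwards [h, qL1_ae z, powMulR_ae (sqrtExponent_pos δ) (sqrtExponent_le δ) z]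
        with t h0 h1 h2
      filter_upwards [h0, h1, h2] with x h0 h1 h2
      rw [h1, h2, abs_of_nonneg h0.1, h0.2.2.2]
  · rintro ⟨ha, hb, hc⟩
    change ∀ᵐ t : Time T, ∀ᵐ x : Torus, _
    filter_upwards [ha, hb, hc, momL1_ae z, powMulR_ae (momExponent_pos δ) le_rfl z, qL1_ae z,
      powMulR_ae (sqrtExponent_pos δ) (sqrtExponent_le δ) z] with t h1 h2 h3 h4 h5 h6 h7
    replace h1 : ∀ᵐ x : Torus, 0 ≤ z.rho t x ∧ z.theta t x = Real.sqrt (z.rho t x) := h1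
    filter_upwards [h1, h2, h3, h4, h5, h6, h7] with x h1 h2 h3 h4 h5 h6 h7
    rw [abs_of_nonneg h1.1] at h5 h7
    exact ⟨h1.1, h1.2, by rw [← h4, h2, h5], by rw [← h6, h3, h7]⟩

/-! ### Closedness on bounded sets, measurability and stability of the identities. -/

/-- The elements of the path space whose fourth and fifth components have norm at most `N`. -/
def bounded (T : ℝ) (δ : Set.Ioo (0 : ℝ) 1) (q : Set.Ico (1 : ℝ) 3) (r : Set.Ici (1 : ℝ))
    (α : Set.Ico (1 : ℝ) (3 / 2)) (N : ℝ) : Set (PathSpace T δ q r α) :=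
  {z | z.qPart ∈ LInftyWStar.dualBall T _ N ∧ z.rPart ∈ LInftyWStar.dualBall T _ N}

theorem isClosed_bounded (N : ℝ) : IsClosed (bounded T δ q r α N) :=
  ((LInftyWStar.isClosed_dualBall N).preimage continuous_qPart).inter
    ((LInftyWStar.isClosed_dualBall N).preimage continuous_rPart)

theorem exists_forall_mem_bounded {z : ℕ → PathSpace T δ q r α} {z₀ : PathSpace T δ q r α}
    (h : Tendsto z atTop (𝓝 z₀)) : ∃ N : ℕ, ∀ n, z n ∈ bounded T δ q r α N := by
  obtain ⟨N₁, h₁⟩ := LInftyWStar.exists_forall_mem_dualBall ((continuous_qPart.tendsto z₀).comp h)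
  obtain ⟨N₂, h₂⟩ := LInftyWStar.exists_forall_mem_dualBall ((continuous_rPart.tendsto z₀).comp h)
  obtain ⟨N, hN⟩ := exists_nat_ge (max N₁ N₂)
  exact ⟨N, fun n =>
    ⟨LInftyWStar.dualBall_mono ((le_max_left _ _).trans hN) (h₁ n),
      LInftyWStar.dualBall_mono ((le_max_right _ _).trans hN) (h₂ n)⟩⟩

theorem continuousOn_powMulR {c : ℝ} (hc : 0 < c) (h : c ≤ (1 + (δ : ℝ)) / (2 + (δ : ℝ))) (N : ℝ)
    (E : Set (Time T)) (hE : MeasurableSet E)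
    (Λ : StrongDual ℝ (Lp Vec 1 (volume : Measure Torus))) :
    ContinuousOn (fun z : PathSpace T δ q r α => Λ (∫ t in E, powMulR hc h z t))
      (bounded T δ q r α N) :=
  LInftyWStar.continuousOn_apply
    ((ContinuousMap.continuous_postcomp _).comp continuous_rhoPart) continuous_rPart
    (fun _ hz => hz.2) E hE Λ

theorem isClosed_identified_inter_bounded (N : ℝ) :
    IsClosed {z ∈ bounded T δ q r α N | z.Identified} := by
  have h1 : IsClosed {z : PathSpace T δ q r α | ∀ᵐ t, rhoTheta z t ∈ sqrtGraph q} :=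
    (isClosed_setOf_ae_mem (isClosed_sqrtGraph q)).preimage continuous_rhoTheta
  have h2 := isClosed_setOf_eq_of_weak (isClosed_bounded (T := T) (δ := δ) (q := q) (r := r)
    (α := α) N) (f := momL1) (g := powMulR (momExponent_pos δ) le_rfl)
    (fun E _ Λ => (Λ.continuous.comp
      ((continuous_setIntegral E).comp continuous_momL1)).continuousOn)
    (continuousOn_powMulR _ _ N)
  have h3 := isClosed_setOf_eq_of_weak (isClosed_bounded (T := T) (δ := δ) (q := q) (r := r)
    (α := α) N) (f := qL1) (g := powMulR (sqrtExponent_pos δ) (sqrtExponent_le δ))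
    (LInftyWStar.continuousOn_apply continuous_const continuous_qPart fun _ hz => hz.1)
    (continuousOn_powMulR _ _ N)
  convert h1.inter (h2.inter h3) using 1
  ext z
  simp only [mem_ofPred_eq, mem_inter_iff, identified_iff]
  tauto

theorem measurableSet_identified : MeasurableSet {z : PathSpace T δ q r α | z.Identified} := by
  have : {z : PathSpace T δ q r α | z.Identified} =
      ⋃ N : ℕ, {z ∈ bounded T δ q r α N | z.Identified} := by
    ext z
    -- The constant sequence shows that every element lies in some `bounded N`.
    obtain ⟨N, hN⟩ := exists_forall_mem_bounded (tendsto_const_nhds (x := z) (f := atTop))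
    simp only [mem_ofPred_eq, mem_iUnion]
    exact ⟨fun h => ⟨N, hN 0, h⟩, fun ⟨_, _, h⟩ => h⟩
  rw [this]
  exact .iUnion fun N => (isClosed_identified_inter_bounded _).measurableSet

/-- The identities are stable under sequential convergence in the path space. -/
theorem Identified.of_tendsto {z : ℕ → PathSpace T δ q r α} {z₀ : PathSpace T δ q r α}
    (h : Tendsto z atTop (𝓝 z₀)) (hz : ∀ n, (z n).Identified) : z₀.Identified := by
  obtain ⟨N, hN⟩ := exists_forall_mem_bounded h
  exact ((isClosed_identified_inter_bounded N).mem_of_tendsto h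
    (Eventually.of_forall fun n => ⟨hN n, hz n⟩)).2

theorem IsTupleOf.identified {z : PathSpace T δ q r α} {ϱ : Time T → Torus → ℝ}
    {u : Time T → Torus → Vec} {W : C(Time T, ℝ)} (h : z.IsTupleOf ϱ u W) : z.Identified := by
  have h0 := δ.2.1
  have pow_mul : ∀ {a b c : ℝ}, 0 ≤ a → b + 1 / (2 + (δ : ℝ)) = c → c ≠ 0 →
      a ^ c = a ^ b * a ^ (1 / (2 + (δ : ℝ))) := fun ha hbc hc => by
    rw [← hbc] at hc ⊢
    -- Only the total exponent has to be nonzero, so vacuum, `a = 0`, is allowed.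
    exact Real.rpow_add' ha hc
  change ∀ᵐ t : Time T, ∀ᵐ x : Torus, _
  filter_upwards [h.1] with t ht
  filter_upwards [ht] with x ⟨hϱ, hrho, htheta, hmom, hq, hr⟩
  rw [hrho, htheta, hmom, hq, hr, smul_smul, smul_smul]
  refine ⟨hϱ, rfl, ?_, ?_⟩
  · rw [← pow_mul hϱ (c := 1) (by field_simp; ring) one_ne_zero, Real.rpow_one]
  · rw [← pow_mul hϱ (c := 1 / 2) (by field_simp; ring) (by norm_num), Real.sqrt_eq_rpow]

end PathSpace

end

end DegenerateNS

/-! ### Transfer to the new probability space. -/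

theorem lemma4p9
    (T : ℝ) (hT : 0 < T)
    (δ : Set.Ioo (0 : ℝ) 1) (q : Set.Ico (1 : ℝ) 3) (r : Set.Ici (1 : ℝ))
    (α : Set.Ico (1 : ℝ) (3 / 2))
    (hqδ : 3 * (1 + (δ : ℝ)) ≤ (q : ℝ) * (1 + 2 * (δ : ℝ)))
    -- the original probability space, with the densities, the velocities and the driving process
    {Ω : Type*} [MeasurableSpace Ω] (P : MeasureTheory.Measure Ω)
    [MeasureTheory.IsProbabilityMeasure P]
    (ϱ : ℕ → Ω → DegenerateNS.Time T → DegenerateNS.Torus → ℝ)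
    (u : ℕ → Ω → DegenerateNS.Time T → DegenerateNS.Torus → DegenerateNS.Vec)
    (W : Ω → C(DegenerateNS.Time T, ℝ))
    -- the random tuples in the path space that they define
    (μ : ℕ → Ω → DegenerateNS.PathSpace T δ q r α)
    (hμ_meas : ∀ n, Measurable (μ n))
    (hμ : ∀ n, ∀ᵐ ω ∂P, (μ n ω).IsTupleOf (ϱ n ω) (u n ω) (W ω))
    -- a representation of a subsequence on a new probability space, converging almost surely
    {Ω' : Type*} [MeasurableSpace Ω'] (P' : MeasureTheory.Measure Ω')
    [MeasureTheory.IsProbabilityMeasure P']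
    (μ' : ℕ → Ω' → DegenerateNS.PathSpace T δ q r α)
    (hμ'_meas : ∀ n, Measurable (μ' n))
    (μ'_lim : Ω' → DegenerateNS.PathSpace T δ q r α)
    (hμ'_lim_meas : Measurable μ'_lim)
    (k : ℕ → ℕ) (hk : StrictMono k)
    (hlaw : ∀ n, P'.map (μ' n) = P.map (μ (k n)))
    (hconv : ∀ᵐ ω ∂P',
      Filter.Tendsto (fun n => μ' n ω) Filter.atTop (nhds (μ'_lim ω))) :
    (∀ᵐ ω ∂P', ∀ n, (μ' n ω).Identified) ∧ (∀ᵐ ω ∂P', (μ'_lim ω).Identified) := by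
  have hn : ∀ᵐ ω ∂P', ∀ n, (μ' n ω).Identified := by
    rw [MeasureTheory.ae_all_iff]
    intro n
    refine MeasureTheory.ae_of_ae_map (hμ'_meas n).aemeasurable (p := fun z => z.Identified) ?_
    -- Measurability of the identified set is what lets a statement about the common law be pulled
    -- back to the original tuple.
    rw [hlaw n, MeasureTheory.ae_map_iff (hμ_meas (k n)).aemeasurable
      DegenerateNS.PathSpace.measurableSet_identified]
    exact (hμ (k n)).mono fun _ h => h.identified
  refine ⟨hn, ?_⟩
  filter_upwards [hn, hconv] with ω h1 h2
  exact DegenerateNS.PathSpace.Identified.of_tendsto h2 h1
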